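/- Let $(X,\mu)$ be a standard probability space (a standard Borel space with a Borel probability measure) and let $\mathcal G$ be a simple undirected graph on the vertex set $X$ whose edge relation $\sim$ is a Borel subset of $X\times X$. Assume: (i) $\mathcal G$ has bounded degree: there are $d\in\mathbb N$ and a $\mu$-null set $N\subseteq X$ containing all neighbours of its points (possibly $N=\emptyset$) such that every $x\in X\setminus N$ has at most $d$ neighbours; (ii) $\mathcal G$ is probability measure preserving (pmp): every Borel injection $\theta:D\to X$ with Borel domain $D\subseteq X$, such that $x$ and $\theta(x)$ lie in the same connected component of $\mathcal G$ for all $x\in D$, satisfies $\mu(\theta(C))=\mu(C)$ for all Borel $C\subseteq D$; (iii) $\mathcal G$ is approximately measurably bipartite: for every $\varepsilon>0$ there are disjoint $\mu$-measurable sets $A,B\subseteq X$, each containing no two adjacent vertices, with $\mu(A\cup B)>1-\varepsilon$. Then there is a unique bounded linear operator $T_{\mathcal G}$ on the complex Hilbert space $L^2(X,\mu)$ such that, for every square-integrable $f:X\to\mathbb C$, $(T_{\mathcal G}f)(x)=\sum_{y\sim x}f(y)$ for $\mu$-almost every $x$ (the adjacency operator of $\mathcal G$), and its spectrum is symmetric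 about $0$: if $\lambda\in\sigma(T_{\mathcal G})$, then $-\lambda\in\sigma(T_{\mathcal G})$. -/

import Mathlib

open MeasureTheory

/-- A graph on a Borel space is Borel if its edge relation is a Borel subset of the square. -/
def IsBorelGraph {X : Type*} [MeasurableSpace X] (G : SimpleGraph X) : Prop :=
  MeasurableSet {p : X × X | G.Adj p.1 p.2}

/-- The graph has degree bounded by a constant, after discarding a null set of vertices that is
invariant, i.e. contains all neighbours of its points.
(With the empty set as `N` this is a bound on the degree of every vertex.) -/
def HasBoundedDegree {X : Type*} [MeasurableSpace X] (G : SimpleGraph X) (μ : Measure X) : Prop :=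
  ∃ d : ℕ, ∃ N : Set X, μ N = 0 ∧ (∀ x y, x ∈ N → G.Adj x y → y ∈ N) ∧
    ∀ x, x ∉ N → (G.neighborSet x).encard ≤ d

/-- The graph is probability measure preserving: every partial Borel bijection `θ` (with Borel
domain `D`) that moves points only inside their connected components preserves the measure.
On a nonempty standard Borel space partial Borel functions on Borel domains are exactly the
restrictions of total ones, and the inverse of a Borel injection with Borel domain is again Borel
with Borel domain. -/
def IsPMPGraph {X : Type*} [MeasurableSpace X] (G : SimpleGraph X) (μ : Measure X) : Prop :=
  ∀ (D : Set X) (θ : X → X), MeasurableSet D → Measurable θ → Set.InjOn θ D →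
    (∀ x ∈ D, G.Reachable x (θ x)) →
      ∀ C : Set X, C ⊆ D → MeasurableSet C → μ (θ '' C) = μ C

/-- Approximate measurable bipartiteness; "measurable" means measurable for the completion. -/
def IsApproxMeasurablyBipartite {X : Type*} [MeasurableSpace X] (G : SimpleGraph X)
    (μ : Measure X) : Prop :=
  ∀ ε : ℝ, 0 < ε → ∃ A B : Set X, NullMeasurableSet A μ ∧ NullMeasurableSet B μ ∧
    Disjoint A B ∧ G.IsIndepSet A ∧ G.IsIndepSet B ∧ 1 - ε < μ.real (A ∪ B)

/-- `T` is the adjacency operator of `G` on complex `L²`: for every square-integrable function `f`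
(whichever representative of its class is taken), `(T f)(x) = ∑_{y ∼ x} f y` for almost all `x`. -/
def IsAdjacencyOperator {X : Type*} [MeasurableSpace X] (G : SimpleGraph X) (μ : Measure X)
    (T : Lp ℂ 2 μ →L[ℂ] Lp ℂ 2 μ) : Prop :=
  ∀ (f : X → ℂ) (hf : MemLp f 2 μ),
    T (hf.toLp f) =ᵐ[μ] fun x => ∑ᶠ y ∈ G.neighborSet x, f y

/-- The spectrum of a bounded operator is symmetric about `0`. -/
def HasSymmetricSpectrum {H : Type*} [NormedAddCommGroup H] [NormedSpace ℂ H]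
    (T : H →L[ℂ] H) : Prop :=
  ∀ z : ℂ, z ∈ spectrum ℂ T → -z ∈ spectrum ℂ T

/-! If `A`, `B` were an exact bipartition and `U` multiplication by the function that is `-1` on `B`
and `1` elsewhere, then `U T U = -T`, and the spectrum would be symmetric. With an approximate
bipartition, `U T U + T` is small only strongly: for one given vector `f`, with `U` depending on
`f`. This suffices because `T` is self-adjoint. If `-z` is not in the spectrum, the resolvent gives
one constant `C` with `‖g‖ ≤ C ‖(-z - T) g‖` for all `g`. Taking `g = U f` and letting the error
tend to `0` gives `‖f‖ ≤ C ‖(z - T) f‖` for each `f`, and a self-adjoint operator bounded below is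
invertible (`hasSymmetricSpectrum_of_conj_approx_neg`).

To construct `T`, the oriented edges are split into finitely many graphs of Borel partial
injections, closed under reversal (`exists_borelEdgeDecomposition`). By the pmp property each
induces a contraction of `L²`, and reversal gives its adjoint. Their sum is bounded and
self-adjoint. -/

/-! ### Borel decomposition of the edges -/

/-- The points over which a Borel set with uniformly finite sections has at least `k` points form
a Borel set. -/
theorem measurableSet_le_encard_section {Y X : Type*} [MeasurableSpace Y] [StandardBorelSpace Y]
    [MeasurableSpace X] [StandardBorelSpace X] {E : Set (Y × X)} (hE : MeasurableSet E) (d : ℕ)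
    (hd : ∀ y, {x | (y, x) ∈ E}.encard ≤ d) (k : ℕ) :
    MeasurableSet {y | (k : ℕ∞) ≤ {x | (y, x) ∈ E}.encard} := by
  obtain ⟨e, he⟩ := exists_measurableEmbedding_real X
  let _ : LinearOrder X := LinearOrder.lift' e he.injective
  have hlt : ∀ a b : X, a < b ↔ e a < e b := fun a b => Iff.rfl
  rcases le_or_gt k (d + 1) with hk | hk
  · induction hk using Nat.decreasingInduction with
    | self =>
      convert MeasurableSet.empty
      ext y
      simp only [Set.mem_ofPred_eq, Set.mem_empty_iff_false, iff_false, not_le]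
      exact (hd y).trans_lt (by exact_mod_cast Nat.lt_succ_self d)
    | of_succ k hk ih =>
      -- Pairs of a point whose section has exactly `k` elements and the increasing enumeration of
      -- that section. The enumeration is unique, so `S` projects injectively and its image is Borel
      -- by Lusin–Souslin.
      set S : Set (Y × (Fin k → X)) := {p | StrictMono p.2 ∧ (∀ i, (p.1, p.2 i) ∈ E)} ∩
        Prod.fst ⁻¹' {y | ((k + 1 : ℕ) : ℕ∞) ≤ {x | (y, x) ∈ E}.encard}ᶜ with hS
      have hSm : MeasurableSet S := by
        refine MeasurableSet.inter ?_ (measurable_fst ih.compl)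
        have h1 : {p : Y × (Fin k → X) | StrictMono p.2 ∧ (∀ i, (p.1, p.2 i) ∈ E)} =
            (⋂ i, ⋂ j, ⋂ (_ : i < j), {p | e (p.2 i) < e (p.2 j)}) ∩
              ⋂ i, (fun p : Y × (Fin k → X) => (p.1, p.2 i)) ⁻¹' E := by
          ext p
          simp [StrictMono, hlt]
        rw [h1]
        refine MeasurableSet.inter ?_ ?_
        · refine .iInter fun i => .iInter fun j => .iInter fun _ => measurableSet_lt ?_ ?_
          · exact he.measurable.comp ((measurable_pi_apply i).comp measurable_snd)
          · exact he.measurable.comp ((measurable_pi_apply j).comp measurable_snd)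
        · refine .iInter fun i => ?_
          exact (measurable_fst.prodMk ((measurable_pi_apply i).comp measurable_snd)) hE
      have hrange : ∀ p ∈ S, Set.range p.2 = {x | (p.1, x) ∈ E} := by
        rintro ⟨y, v⟩ ⟨⟨hv, hvE⟩, hy⟩
        have hfin : {x | (y, x) ∈ E}.Finite :=
          Set.finite_of_encard_le_coe (hd y)
        refine hfin.eq_of_subset_of_encard_le' (Set.range_subset_iff.2 hvE) ?_
        rw [← Set.image_univ, hv.injective.encard_image, Set.encard_univ]
        simp only [ENat.card_eq_coe_fintype_card, Fintype.card_fin]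
        simp only [Set.preimage_compl, Set.mem_compl_iff, Set.mem_preimage, Set.mem_ofPred_eq,
          not_le] at hy
        push_cast at hy
        exact Order.le_of_lt_add_one hy
      have hinj : Set.InjOn Prod.fst S := by
        rintro ⟨y, v⟩ hv ⟨y', w⟩ hw (rfl : y = y')
        have := (hv.1.1.range_inj hw.1.1).1 ((hrange _ hv).trans (hrange _ hw).symm)
        simp only at this
        rw [this]
      convert ih.union (hSm.image_of_measurable_injOn measurable_fst hinj) using 1
      ext y
      simp only [Set.mem_ofPred_eq, Set.mem_union, Set.mem_image]
      constructor
      · intro hy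
        by_cases hy' : ((k + 1 : ℕ) : ℕ∞) ≤ {x | (y, x) ∈ E}.encard
        · exact Or.inl hy'
        · right
          obtain ⟨t, ht, htk⟩ := Set.exists_subset_encard_eq hy
          have htf : t.Finite := Set.finite_of_encard_eq_coe htk
          have hc : htf.toFinset.card = k := by
            rw [htf.encard_eq_coe_toFinset_card] at htk
            exact_mod_cast htk
          refine ⟨(y, htf.toFinset.orderEmbOfFin hc), ⟨⟨OrderEmbedding.strictMono _, fun i => ?_⟩,
            hy'⟩, rfl⟩
          have := Finset.orderEmbOfFin_mem htf.toFinset hc i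
          exact ht (htf.mem_toFinset.1 this)
      · rintro (h | ⟨⟨y, v⟩, hp, rfl⟩)
        · exact le_trans (by exact_mod_cast Nat.le_succ k) h
        · simp only
          rw [← hrange _ hp, ← Set.image_univ, hp.1.1.injective.encard_image, Set.encard_univ]
          simp
  · convert MeasurableSet.empty
    ext y
    simp only [Set.mem_ofPred_eq, Set.mem_empty_iff_false, iff_false, not_le]
    exact (hd y).trans_lt (by exact_mod_cast (Nat.lt_succ_self d).trans hk)

/-- A decomposition of the oriented edges of a graph into graphs of partial Borel injections
`θ i : D i → X`, closed under reversal of edges. -/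
structure BorelEdgeDecomposition {X : Type*} [MeasurableSpace X] (G : SimpleGraph X)
    (ι : Type*) where
  D : ι → Set X
  θ : ι → X → X
  rev : ι → ι
  rev_involutive : Function.Involutive rev
  measurableSet_D : ∀ i, MeasurableSet (D i)
  measurable_θ : ∀ i, Measurable (θ i)
  adj : ∀ i, ∀ x ∈ D i, G.Adj x (θ i x)
  existsUnique : ∀ x y, G.Adj x y → ∃! i, x ∈ D i ∧ θ i x = y
  θ_mem : ∀ i, ∀ x ∈ D i, θ i x ∈ D (rev i)
  θ_rev : ∀ i, ∀ x ∈ D i, θ (rev i) (θ i x) = x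

/-- A measurable choice of second coordinates on a Borel set with injective first projection. -/
theorem exists_measurable_of_injOn_fst {X : Type*} [MeasurableSpace X] [StandardBorelSpace X]
    {P : Set (X × X)} (hP : MeasurableSet P) (hinj : Set.InjOn Prod.fst P) :
    ∃ θ : X → X, Measurable θ ∧ ∀ p ∈ P, θ p.1 = p.2 := by
  have : StandardBorelSpace P := hP.standardBorel
  have hemb : MeasurableEmbedding (fun p : P => p.1.1) :=
    (measurable_fst.comp measurable_subtype_coe).measurableEmbedding
      fun p q h => Subtype.ext (hinj p.2 q.2 h)
  obtain ⟨θ, hθ, h⟩ := hemb.exists_measurable_extend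
    (g := fun p : P => p.1.2) (measurable_snd.comp measurable_subtype_coe) (fun x => ⟨x⟩)
  exact ⟨θ, hθ, fun p hp => congrFun h ⟨p, hp⟩⟩

/-- An edge `(x, y)` is labelled by the rank of `y` among the neighbours of `x` and the rank of `x`
among those of `y`, in an order pulled back from `ℝ`. The first rank and `x` determine `y`;
reversing the edge swaps the two ranks. -/
theorem exists_borelEdgeDecomposition {X : Type*} [MeasurableSpace X] [StandardBorelSpace X]
    {G : SimpleGraph X} (hG : IsBorelGraph G) (d : ℕ)
    (hd : ∀ x, (G.neighborSet x).encard ≤ d) :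
    Nonempty (BorelEdgeDecomposition G (Fin d × Fin d)) := by
  obtain ⟨e, he⟩ := exists_measurableEmbedding_real X
  set L : X → X → Set X := fun x y => {z | G.Adj x z ∧ e z < e y} with hL
  have hLsub : ∀ x y, L x y ⊆ G.neighborSet x := fun x y z hz => hz.1
  have hLd : ∀ x y, (L x y).encard ≤ d := fun x y => (Set.encard_le_encard (hLsub x y)).trans (hd x)
  have hNfin : ∀ x, (G.neighborSet x).Finite := fun x => Set.finite_of_encard_le_coe (hd x)
  have hlt : ∀ x y, G.Adj x y → (L x y).encard < d := fun x y hxy => by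
    refine lt_of_lt_of_le (((hNfin x).subset (hLsub x y)).encard_lt_encard
      ((Set.ssubset_iff_of_subset (hLsub x y)).2 ⟨y, hxy, fun h => lt_irrefl _ h.2⟩)) (hd x)
  have hstrict : ∀ x y y', G.Adj x y → e y < e y' → (L x y).encard < (L x y').encard := by
    intro x y y' hxy hyy'
    refine ((hNfin x).subset (hLsub x y)).encard_lt_encard ?_
    have hsub : L x y ⊆ L x y' := fun z hz => ⟨hz.1, lt_trans hz.2 hyy'⟩
    refine (Set.ssubset_iff_of_subset hsub).2
      ⟨y, ⟨hxy, hyy'⟩, fun h => lt_irrefl _ h.2⟩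
  have hinj : ∀ x y y', G.Adj x y → G.Adj x y' → (L x y).encard = (L x y').encard → y = y' := by
    intro x y y' h h' heq
    rcases lt_trichotomy (e y) (e y') with h1 | h1 | h1
    · exact absurd heq (hstrict x y y' h h1).ne
    · exact he.injective h1
    · exact absurd heq (hstrict x y' y h' h1).ne'
  have hge : ∀ k : ℕ, MeasurableSet {p : X × X | (k : ℕ∞) ≤ (L p.1 p.2).encard} := by
    intro k
    refine measurableSet_le_encard_section
      (E := {q : (X × X) × X | G.Adj q.1.1 q.2 ∧ e q.2 < e q.1.2}) ?_ d (fun p => hLd p.1 p.2) k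
    refine MeasurableSet.inter (s₁ := {q : (X × X) × X | G.Adj q.1.1 q.2})
      (s₂ := {q | e q.2 < e q.1.2}) ?_ (measurableSet_lt ?_ ?_)
    · exact ((measurable_fst.comp measurable_fst).prodMk measurable_snd) hG
    · exact he.measurable.comp measurable_snd
    · exact he.measurable.comp (measurable_snd.comp measurable_fst)
  have heq : ∀ k : ℕ, MeasurableSet {p : X × X | (L p.1 p.2).encard = k} := by
    intro k
    convert (hge k).diff (hge (k + 1)) using 1
    ext p
    simp only [Set.mem_ofPred_eq, Set.mem_sdiff, not_le]
    push_cast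
    exact ⟨fun h => by rw [h]; exact ⟨le_rfl, by exact_mod_cast Nat.lt_succ_self k⟩,
      fun h => le_antisymm (Order.le_of_lt_add_one h.2) h.1⟩
  set P : Fin d × Fin d → Set (X × X) := fun i => {p | G.Adj p.1 p.2} ∩
    {p | (L p.1 p.2).encard = (i.1 : ℕ)} ∩
      Prod.swap ⁻¹' {p : X × X | (L p.1 p.2).encard = (i.2 : ℕ)} with hPdef
  have hPm : ∀ i, MeasurableSet (P i) := fun i =>
    (MeasurableSet.inter hG (heq _)).inter (measurable_swap (heq _))
  have hPinj : ∀ i, Set.InjOn Prod.fst (P i) := by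
    rintro i ⟨x, y⟩ ⟨⟨h1, h2⟩, -⟩ ⟨x', y'⟩ ⟨⟨h1', h2'⟩, -⟩ (rfl : x = x')
    exact Prod.ext rfl (hinj x y y' h1 h1' (Eq.trans h2 (Eq.symm h2')))
  have hPswap : ∀ i x y, (x, y) ∈ P i → (y, x) ∈ P i.swap :=
    fun i x y h => ⟨⟨SimpleGraph.Adj.symm h.1.1, h.2⟩, h.1.2⟩
  choose θ hθm hθ using fun i => exists_measurable_of_injOn_fst (hPm i) (hPinj i)
  have hDP : ∀ i, ∀ x ∈ Prod.fst '' P i, (x, θ i x) ∈ P i := by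
    rintro i _ ⟨⟨x, y⟩, hp, rfl⟩
    rwa [hθ i _ hp]
  exact ⟨{
    D := fun i => Prod.fst '' P i
    θ := θ
    rev := Prod.swap
    rev_involutive := Prod.swap_swap
    measurableSet_D := fun i => (hPm i).image_of_measurable_injOn measurable_fst (hPinj i)
    measurable_θ := hθm
    adj := fun i x hx => (hDP i x hx).1.1
    existsUnique := by
      intro x y hxy
      have h1 := hlt x y hxy
      have h2 := hlt y x hxy.symm
      obtain ⟨a, ha⟩ := ENat.ne_top_iff_exists.1 h1.ne_top
      obtain ⟨b, hb⟩ := ENat.ne_top_iff_exists.1 h2.ne_top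
      rw [← ha] at h1
      rw [← hb] at h2
      have h1' : a < d := by exact_mod_cast h1
      have h2' : b < d := by exact_mod_cast h2
      have hm : (x, y) ∈ P (⟨a, h1'⟩, ⟨b, h2'⟩) := ⟨⟨hxy, ha.symm⟩, hb.symm⟩
      refine ⟨(⟨a, h1'⟩, ⟨b, h2'⟩), ⟨⟨_, hm, rfl⟩, hθ _ _ hm⟩, ?_⟩
      rintro ⟨i, j⟩ ⟨hx, rfl⟩
      have h3 := hDP _ x hx
      have hi : ((a : ℕ) : ℕ∞) = (i : ℕ) := ha.trans h3.1.2
      have hj : ((b : ℕ) : ℕ∞) = (j : ℕ) := hb.trans h3.2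
      have hi' : a = i := by exact_mod_cast hi
      have hj' : b = j := by exact_mod_cast hj
      exact Prod.ext (Fin.ext hi'.symm) (Fin.ext hj'.symm)
    θ_mem := fun i x hx => ⟨_, hPswap _ _ _ (hDP i x hx), rfl⟩
    θ_rev := fun i x hx => hθ _ _ (hPswap _ _ _ (hDP i x hx)) }⟩

/-- A graph of bounded degree agrees, near almost every vertex, with a Borel subgraph in which all
vertices have bounded degree. -/
theorem exists_subgraph_encard_neighborSet_le {X : Type*} [MeasurableSpace X] {μ : Measure X}
    {G : SimpleGraph X} (hG : IsBorelGraph G) (hdeg : HasBoundedDegree G μ) :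
    ∃ H : SimpleGraph X, H ≤ G ∧ IsBorelGraph H ∧
      (∃ d : ℕ, ∀ x, (H.neighborSet x).encard ≤ d) ∧
      ∀ᵐ x ∂μ, H.neighborSet x = G.neighborSet x := by
  obtain ⟨d, N, hN, hinv, hd⟩ := hdeg
  set M := toMeasurable μ N
  have hM : MeasurableSet M := measurableSet_toMeasurable μ N
  have hNM : N ⊆ M := subset_toMeasurable μ N
  have hMnull : μ M = 0 := (measure_toMeasurable N).trans hN
  -- The measurable hull `M` need not be invariant, so only edges with both ends in `M` are deleted.
  -- Points of `N` become isolated, since their neighbours lie in `N ⊆ M`, and points outside `M`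
  -- keep all their edges.
  let H : SimpleGraph X :=
    { Adj := fun x y => G.Adj x y ∧ (x ∉ M ∨ y ∉ M)
      symm := ⟨fun x y h => ⟨h.1.symm, h.2.symm⟩⟩
      loopless := ⟨fun x h => G.loopless.irrefl x h.1⟩ }
  refine ⟨H, fun x y h => h.1, ?_, ⟨d, fun x => ?_⟩, ?_⟩
  · exact MeasurableSet.inter hG ((measurable_fst hM.compl).union (measurable_snd hM.compl))
  · by_cases hx : x ∈ N
    · have : H.neighborSet x = ∅ := by
        ext y
        simp only [SimpleGraph.mem_neighborSet, Set.mem_empty_iff_false, iff_false]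
        rintro ⟨h, h'⟩
        exact h'.elim (fun h' => h' (hNM hx)) (fun h' => h' (hNM (hinv x y hx h)))
      simp [this]
    · exact (Set.encard_le_encard fun y hy => hy.1).trans (hd x hx)
  · have : ∀ᵐ x ∂μ, x ∉ M := measure_eq_zero_iff_ae_notMem.1 hMnull
    filter_upwards [this] with x hx
    ext y
    exact ⟨fun h => h.1, fun h => ⟨h, Or.inl hx⟩⟩

/-! ### Spectral symmetry from approximate conjugation -/

/-- A self-adjoint operator which is bounded below is invertible. -/
theorem IsSelfAdjoint.isUnit_of_bound {H : Type*} [NormedAddCommGroup H] [InnerProductSpace ℂ H]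
    [CompleteSpace H] {S : H →L[ℂ] H} (hS : IsSelfAdjoint S) {c : ℝ} (hc : 0 < c)
    (h : ∀ f, c * ‖f‖ ≤ ‖S f‖) : IsUnit S := by
  have hker : S.ker = ⊥ := by
    rw [eq_bot_iff]
    intro f hf
    have h0 : S f = 0 := hf
    have := h f
    rw [h0, norm_zero] at this
    have : ‖f‖ ≤ 0 := by nlinarith [norm_nonneg f]
    simpa using this
  have hanti : AntilipschitzWith (Real.toNNReal c⁻¹) S := by
    refine S.antilipschitz_of_bound fun f => ?_
    rw [Real.coe_toNNReal _ (by positivity), inv_mul_eq_div, le_div_iff₀ hc, mul_comm]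
    exact h f
  rw [ContinuousLinearMap.isUnit_iff_bijective,
    ContinuousLinearMap.bijective_iff_dense_range_and_antilipschitz]
  refine ⟨?_, _, hanti⟩
  -- The range is dense because its orthogonal complement is the kernel of the adjoint, here `S`
  -- itself.
  rw [Submodule.topologicalClosure_eq_top_iff, ContinuousLinearMap.orthogonal_range,
    hS.adjoint_eq, hker]

/-- A self-adjoint operator that can be conjugated arbitrarily close to its negative, in the
strong operator topology, by isometric involutions has symmetric spectrum. -/
theorem hasSymmetricSpectrum_of_conj_approx_neg {H : Type*} [NormedAddCommGroup H]
    [InnerProductSpace ℂ H] [CompleteSpace H] {T : H →L[ℂ] H} (hT : IsSelfAdjoint T)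
    (happrox : ∀ (f : H) (ε : ℝ), 0 < ε → ∃ U : H →L[ℂ] H, (∀ g, ‖U g‖ = ‖g‖) ∧
      (∀ g, U (U g) = g) ∧ ‖U (T (U f)) + T f‖ ≤ ε) :
    HasSymmetricSpectrum T := by
  intro z hz
  have hre : z = (z.re : ℂ) := hT.mem_spectrum_eq_re hz
  by_contra hneg
  apply hz
  have hzsa : IsSelfAdjoint z := by
    rw [hre]
    exact Complex.conj_ofReal _
  have hsa : IsSelfAdjoint (algebraMap ℂ (H →L[ℂ] H) z - T) :=
    (IsSelfAdjoint.algebraMap _ hzsa).sub hT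
  have hunit : IsUnit (algebraMap ℂ (H →L[ℂ] H) (-z) - T) := by
    simpa [spectrum.mem_iff] using hneg
  obtain ⟨u, hu⟩ := hunit
  set R : H →L[ℂ] H := ↑u⁻¹ with hR
  have hRu : ∀ g, R ((-z) • g - T g) = g := by
    intro g
    have h1 : R * (algebraMap ℂ (H →L[ℂ] H) (-z) - T) = 1 := by rw [← hu, hR, Units.inv_mul]
    simpa [Algebra.algebraMap_eq_smul_one] using congrArg (fun A : H →L[ℂ] H => A g) h1
  -- Adding `1` makes the constant positive without a separate argument that `R ≠ 0`.
  have hbound : ∀ g, ‖g‖ ≤ (‖R‖ + 1) * ‖(-z) • g - T g‖ := fun g => by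
    calc ‖g‖ = ‖R ((-z) • g - T g)‖ := by rw [hRu]
      _ ≤ ‖R‖ * ‖(-z) • g - T g‖ := R.le_opNorm _
      _ ≤ _ := by gcongr; linarith
  have hR1 : 0 < ‖R‖ + 1 := by positivity
  refine hsa.isUnit_of_bound (inv_pos.2 hR1) fun f => ?_
  rw [inv_mul_eq_div, div_le_iff₀' hR1]
  refine le_of_forall_pos_le_add fun ε hε => ?_
  obtain ⟨U, hU, hUU, hUT⟩ := happrox f (ε / (‖R‖ + 1)) (by positivity)
  have key : U ((-z) • U f - T (U f)) = -(z • f - T f) - (U (T (U f)) + T f) := by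
    rw [map_sub, map_smul, hUU]
    module
  have h1 : (algebraMap ℂ (H →L[ℂ] H) z - T) f = z • f - T f := by
    simp [Algebra.algebraMap_eq_smul_one]
  rw [h1]
  calc ‖f‖ = ‖U f‖ := (hU f).symm
    _ ≤ (‖R‖ + 1) * ‖(-z) • U f - T (U f)‖ := hbound _
    _ = (‖R‖ + 1) * ‖-(z • f - T f) - (U (T (U f)) + T f)‖ := by rw [← hU, key]
    _ ≤ (‖R‖ + 1) * (‖z • f - T f‖ + ε / (‖R‖ + 1)) := by
      gcongr
      refine (norm_sub_le _ _).trans ?_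
      rw [norm_neg]
      gcongr
    _ = (‖R‖ + 1) * ‖z • f - T f‖ + ε := by field_simp

/-! ### Composition with partial measure-preserving maps -/

section PartialComposition

variable {X : Type*} [MeasurableSpace X] {μ : Measure X} {D D' : Set X} {θ : X → X}

theorem MeasureTheory.MemLp.indicator_comp {f : X → ℂ} (hf : MemLp f 2 μ) (hD : MeasurableSet D)
    (hθ : MeasurePreserving θ (μ.restrict D) (μ.restrict D')) :
    MemLp (D.indicator (f ∘ θ)) 2 μ :=
  (memLp_indicator_iff_restrict hD).2 ((hf.restrict D').comp_measurePreserving hθ)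

theorem indicator_comp_congr_ae {f g : X → ℂ} (h : f =ᵐ[μ] g) (hD : MeasurableSet D)
    (hθ : MeasurePreserving θ (μ.restrict D) (μ.restrict D')) :
    D.indicator (f ∘ θ) =ᵐ[μ] D.indicator (g ∘ θ) := by
  have h1 : f ∘ θ =ᵐ[μ.restrict D] g ∘ θ :=
    hθ.quasiMeasurePreserving.ae_eq_comp (ae_restrict_of_ae h)
  filter_upwards [(ae_restrict_iff' hD).1 h1] with x hx
  by_cases hxD : x ∈ D
  · simpa [hxD] using hx hxD
  · simp [hxD]

theorem eLpNorm_indicator_comp_le {f : X → ℂ} (hf : MemLp f 2 μ) (hD : MeasurableSet D)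
    (hθ : MeasurePreserving θ (μ.restrict D) (μ.restrict D')) :
    eLpNorm (D.indicator (f ∘ θ)) 2 μ ≤ eLpNorm f 2 μ := by
  rw [eLpNorm_indicator_eq_eLpNorm_restrict hD,
    eLpNorm_comp_measurePreserving hf.1.restrict hθ]
  exact eLpNorm_mono_measure _ Measure.restrict_le_self

/-- The contraction `f ↦ 1_D · (f ∘ θ)` of `L²` given by a partial measure preserving map. -/
noncomputable def partialComp (hD : MeasurableSet D)
    (hθ : MeasurePreserving θ (μ.restrict D) (μ.restrict D')) : Lp ℂ 2 μ →L[ℂ] Lp ℂ 2 μ :=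
  LinearMap.mkContinuous
    { toFun := fun f => ((Lp.memLp f).indicator_comp hD hθ).toLp _
      map_add' := fun f g => by
        rw [← MemLp.toLp_add]
        refine MemLp.toLp_congr _ _ ((indicator_comp_congr_ae (Lp.coeFn_add f g) hD hθ).trans ?_)
        refine Filter.Eventually.of_forall fun x => ?_
        by_cases hx : x ∈ D <;> simp [hx]
      map_smul' := fun c f => by
        rw [RingHom.id_apply, ← MemLp.toLp_const_smul]
        refine MemLp.toLp_congr _ _ ((indicator_comp_congr_ae (Lp.coeFn_smul c f) hD hθ).trans ?_)
        refine Filter.Eventually.of_forall fun x => ?_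
        by_cases hx : x ∈ D <;> simp [hx] } 1
    (fun f => by
      rw [one_mul]
      change ‖((Lp.memLp f).indicator_comp hD hθ).toLp _‖ ≤ ‖f‖
      rw [Lp.norm_toLp, Lp.norm_def]
      exact ENNReal.toReal_mono (Lp.eLpNorm_ne_top f)
        (eLpNorm_indicator_comp_le (Lp.memLp f) hD hθ))

theorem partialComp_coeFn (hD : MeasurableSet D)
    (hθ : MeasurePreserving θ (μ.restrict D) (μ.restrict D')) (f : Lp ℂ 2 μ) :
    partialComp hD hθ f =ᵐ[μ] D.indicator (f ∘ θ) :=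
  MemLp.coeFn_toLp ((Lp.memLp f).indicator_comp hD hθ)

theorem partialComp_toLp (hD : MeasurableSet D)
    (hθ : MeasurePreserving θ (μ.restrict D) (μ.restrict D')) {f : X → ℂ} (hf : MemLp f 2 μ) :
    partialComp hD hθ (hf.toLp f) =ᵐ[μ] D.indicator (f ∘ θ) :=
  (partialComp_coeFn hD hθ _).trans (indicator_comp_congr_ae hf.coeFn_toLp hD hθ)

theorem norm_partialComp_le (hD : MeasurableSet D)
    (hθ : MeasurePreserving θ (μ.restrict D) (μ.restrict D')) (f : Lp ℂ 2 μ) :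
    ‖partialComp hD hθ f‖ ≤ ‖f‖ := by
  change ‖((Lp.memLp f).indicator_comp hD hθ).toLp _‖ ≤ ‖f‖
  rw [Lp.norm_toLp, Lp.norm_def]
  exact ENNReal.toReal_mono (Lp.eLpNorm_ne_top f)
    (eLpNorm_indicator_comp_le (Lp.memLp f) hD hθ)

/-- Partial compositions with mutually inverse maps are adjoint to each other. -/
theorem inner_partialComp (hD : MeasurableSet D) (hD' : MeasurableSet D') {θ' : X → X}
    (hθ : MeasurePreserving θ (μ.restrict D) (μ.restrict D'))
    (hθ' : MeasurePreserving θ' (μ.restrict D') (μ.restrict D))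
    (hinv : ∀ x ∈ D, θ' (θ x) = x) (f g : Lp ℂ 2 μ) :
    inner ℂ (partialComp hD hθ f) g = inner ℂ f (partialComp hD' hθ' g) := by
  rw [L2.inner_def, L2.inner_def]
  -- Writing `g x` as `g (θ' (θ x))` on `D` makes the integrand a function of `θ x`, ready for the
  -- change of variables to `D'`.
  have h1 : ∫ x, inner ℂ (partialComp hD hθ f x) (g x) ∂μ =
      ∫ x in D, inner ℂ (f (θ x)) (g (θ' (θ x))) ∂μ := by
    rw [← integral_indicator hD]
    refine integral_congr_ae ?_
    filter_upwards [partialComp_coeFn hD hθ f] with x hx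
    rw [hx]
    by_cases hxD : x ∈ D
    · simp [hxD, hinv x hxD]
    · simp [hxD]
  have h2 : ∫ x, inner ℂ (f x) (partialComp hD' hθ' g x) ∂μ =
      ∫ x in D', inner ℂ (f x) (g (θ' x)) ∂μ := by
    rw [← integral_indicator hD']
    refine integral_congr_ae ?_
    filter_upwards [partialComp_coeFn hD' hθ' g] with x hx
    rw [hx]
    by_cases hxD : x ∈ D' <;> simp [hxD]
  have h3 : AEStronglyMeasurable (fun x => inner ℂ (f x) (g (θ' x))) (μ.restrict D') :=
    (Lp.aestronglyMeasurable f).restrict.inner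
      ((Lp.aestronglyMeasurable g).restrict.comp_measurePreserving hθ')
  rw [h1, h2, ← hθ.map_eq, integral_map hθ.aemeasurable (by rwa [hθ.map_eq])]

end PartialComposition

/-! ### Sign multiplications -/

section Indicator

variable {X : Type*} [MeasurableSpace X] {μ : Measure X}

/-- Multiplication by the indicator function of a set. -/
noncomputable def indicatorMul (μ : Measure X) {D : Set X} (hD : MeasurableSet D) :
    Lp ℂ 2 μ →L[ℂ] Lp ℂ 2 μ :=
  partialComp hD (MeasurePreserving.id (μ.restrict D))

theorem indicatorMul_coeFn {D : Set X} (hD : MeasurableSet D) (f : Lp ℂ 2 μ) :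
    indicatorMul μ hD f =ᵐ[μ] D.indicator f :=
  partialComp_coeFn hD _ f

/-- Multiplication by the function that is `-1` on `B` and `1` elsewhere. -/
noncomputable def signMul (μ : Measure X) {B : Set X} (hB : MeasurableSet B) :
    Lp ℂ 2 μ →L[ℂ] Lp ℂ 2 μ :=
  1 - (2 : ℂ) • indicatorMul μ hB

open Classical in
theorem signMul_coeFn {B : Set X} (hB : MeasurableSet B) (f : Lp ℂ 2 μ) :
    signMul μ hB f =ᵐ[μ] fun x => (if x ∈ B then -1 else 1) * f x := by
  have h : signMul μ hB f = f - (2 : ℂ) • indicatorMul μ hB f := rfl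
  rw [h]
  filter_upwards [Lp.coeFn_sub f ((2 : ℂ) • indicatorMul μ hB f),
    Lp.coeFn_smul (2 : ℂ) (indicatorMul μ hB f), indicatorMul_coeFn hB f] with x h1 h2 h3
  rw [h1, Pi.sub_apply, h2, Pi.smul_apply, h3]
  by_cases hx : x ∈ B
  · simp [hx]; ring
  · simp [hx]

theorem norm_signMul {B : Set X} (hB : MeasurableSet B) (f : Lp ℂ 2 μ) :
    ‖signMul μ hB f‖ = ‖f‖ := by
  rw [Lp.norm_def, Lp.norm_def]
  congr 1
  refine eLpNorm_congr_norm_ae ?_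
  filter_upwards [signMul_coeFn hB f] with x hx
  rw [hx]
  split_ifs <;> simp

theorem signMul_signMul {B : Set X} (hB : MeasurableSet B) (f : Lp ℂ 2 μ) :
    signMul μ hB (signMul μ hB f) = f := by
  refine Lp.ext ?_
  filter_upwards [signMul_coeFn hB f, signMul_coeFn hB (signMul μ hB f)] with x h1 h2
  rw [h2, h1]
  split_ifs <;> simp

/-- Multiplication by indicator functions of small sets is small in the strong operator topology. -/
theorem exists_norm_indicatorMul_le (f : Lp ℂ 2 μ) {ε : ℝ} (hε : 0 < ε) :
    ∃ δ : ℝ, 0 < δ ∧ ∀ (R : Set X) (hR : MeasurableSet R), μ R ≤ ENNReal.ofReal δ →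
      ‖indicatorMul μ hR f‖ ≤ ε := by
  obtain ⟨δ, hδ, h⟩ := (Lp.memLp f).eLpNorm_indicator_le (by norm_num) (by norm_num) hε
  refine ⟨δ, hδ, fun R hR hRδ => ?_⟩
  rw [Lp.norm_def, eLpNorm_congr_ae (indicatorMul_coeFn hR f)]
  exact ENNReal.toReal_le_of_le_ofReal hε.le (h R hR hRδ)

/-- Conjugating a partial composition by a sign function that changes its sign along the map, up to
a set `R`, gives its negative up to an error controlled by `R`. -/
theorem norm_conj_partialComp_add_le {D D' B R : Set X} {θ : X → X} (hD : MeasurableSet D)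
    (hB : MeasurableSet B) (hR : MeasurableSet R)
    (hθ : MeasurePreserving θ (μ.restrict D) (μ.restrict D'))
    (hsign : ∀ x ∈ D, x ∉ R → θ x ∉ R → (x ∈ B ↔ θ x ∉ B)) (f : Lp ℂ 2 μ) :
    ‖signMul μ hB (partialComp hD hθ (signMul μ hB f)) + partialComp hD hθ f‖ ≤
      2 * (‖indicatorMul μ hR (partialComp hD hθ f)‖ + ‖indicatorMul μ hR f‖) := by
  classical
  set S := partialComp hD hθ with hS
  -- With `s` the sign function, the left side at `x ∈ D` is `(s x * s (θ x) + 1) * f (θ x)`. It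
  -- vanishes if neither `x` nor `θ x` is in `R`; otherwise its modulus is at most `2 * ‖f (θ x)‖`,
  -- charged to the first term if `x ∈ R` and to the second if `θ x ∈ R`.
  have h0 : ‖signMul μ hB (S (signMul μ hB f)) + S f‖ ≤
      ‖(2 : ℂ) • indicatorMul μ hR (S f)‖ + ‖(2 : ℂ) • S (indicatorMul μ hR f)‖ := by
    set u : X → ℝ := fun x => ‖((2 : ℂ) • indicatorMul μ hR (S f) : Lp ℂ 2 μ) x‖ with hu
    set v : X → ℝ := fun x => ‖((2 : ℂ) • S (indicatorMul μ hR f) : Lp ℂ 2 μ) x‖ with hv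
    have hum : AEStronglyMeasurable u μ := (Lp.aestronglyMeasurable _).norm
    have hvm : AEStronglyMeasurable v μ := (Lp.aestronglyMeasurable _).norm
    have hle : eLpNorm (signMul μ hB (S (signMul μ hB f)) + S f : Lp ℂ 2 μ) 2 μ ≤
        eLpNorm (u + v) 2 μ := by
      refine eLpNorm_mono_ae_real ?_
      filter_upwards [Lp.coeFn_add (signMul μ hB (S (signMul μ hB f))) (S f),
        signMul_coeFn hB (S (signMul μ hB f)),
        partialComp_coeFn hD hθ (signMul μ hB f), partialComp_coeFn hD hθ f,
        indicator_comp_congr_ae (signMul_coeFn hB f) hD hθ,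
        Lp.coeFn_smul (2 : ℂ) (indicatorMul μ hR (S f)), indicatorMul_coeFn hR (S f),
        Lp.coeFn_smul (2 : ℂ) (S (indicatorMul μ hR f)),
        partialComp_coeFn hD hθ (indicatorMul μ hR f),
        indicator_comp_congr_ae (indicatorMul_coeFn hR f) hD hθ]
        with x h1 h2 h3 h4 h5 h6 h7 h8 h9 h10
      simp only [hu, hv, Pi.add_apply, Pi.smul_apply, h1, h2, h6, h8, ← hS] at h3 h4 h9 ⊢
      rw [h3, h5, h7, h9, h10]
      by_cases hxR : x ∈ R
      · rw [Set.indicator_of_mem hxR, h4]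
        by_cases hxD : x ∈ D
        · simp only [hxD, Set.indicator_of_mem, Function.comp_apply]
          refine le_add_of_le_of_nonneg ((norm_add_le _ _).trans ?_) (norm_nonneg _)
          rw [norm_smul]
          split_ifs <;> simp <;> linarith
        · simp [hxD]
      · rw [Set.indicator_of_notMem hxR, h4]
        by_cases hxD : x ∈ D
        · simp only [hxD, Set.indicator_of_mem, Function.comp_apply]
          by_cases hθR : θ x ∈ R
          · simp only [hθR, Set.indicator_of_mem]
            refine le_add_of_nonneg_of_le (norm_nonneg _) ((norm_add_le _ _).trans ?_)
            rw [norm_smul]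
            split_ifs <;> simp <;> linarith
          · have := hsign x hxD hxR hθR
            by_cases hxB : x ∈ B
            · have h' := this.1 hxB
              simp [hxB, h', hθR]
            · have h' : θ x ∈ B := by tauto
              simp [hxB, h', hθR]
        · simp [hxD]
    rw [Lp.norm_def, Lp.norm_def, Lp.norm_def, ← ENNReal.toReal_add (Lp.eLpNorm_ne_top _)
      (Lp.eLpNorm_ne_top _)]
    refine ENNReal.toReal_mono (ENNReal.add_ne_top.2 ⟨Lp.eLpNorm_ne_top _, Lp.eLpNorm_ne_top _⟩) ?_
    refine hle.trans ((eLpNorm_add_le hum hvm (by norm_num)).trans_eq ?_)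
    rw [hu, hv, eLpNorm_norm, eLpNorm_norm]
  rw [norm_smul, norm_smul] at h0
  have h1 := norm_partialComp_le hD hθ (indicatorMul μ hR f)
  have h2 : ‖(2 : ℂ)‖ = 2 := by norm_num
  rw [h2] at h0
  linarith

end Indicator

/-! ### The adjacency operator of a pmp graph -/

theorem IsPMPGraph.mono {X : Type*} [MeasurableSpace X] {μ : Measure X} {G H : SimpleGraph X}
    (h : H ≤ G) (hG : IsPMPGraph G μ) : IsPMPGraph H μ :=
  fun D θ hD hθ hinj hreach => hG D θ hD hθ hinj fun x hx => (hreach x hx).mono h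

/-- The parts of an approximate bipartition can be chosen Borel. -/
theorem IsApproxMeasurablyBipartite.exists_measurableSet {X : Type*} [MeasurableSpace X]
    {μ : Measure X} [IsProbabilityMeasure μ] {G : SimpleGraph X}
    (hG : IsApproxMeasurablyBipartite G μ) {δ : ℝ} (hδ : 0 < δ) :
    ∃ A B : Set X, MeasurableSet A ∧ MeasurableSet B ∧ Disjoint A B ∧ G.IsIndepSet A ∧
      G.IsIndepSet B ∧ μ (A ∪ B)ᶜ ≤ ENNReal.ofReal δ := by
  obtain ⟨A, B, hA, hB, hAB, hAi, hBi, hμ⟩ := hG δ hδ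
  obtain ⟨A', hA', hA'm, hA'e⟩ := hA.exists_measurable_subset_ae_eq
  obtain ⟨B', hB', hB'm, hB'e⟩ := hB.exists_measurable_subset_ae_eq
  refine ⟨A', B', hA'm, hB'm, hAB.mono hA' hB', hAi.mono hA', hBi.mono hB', ?_⟩
  rw [← measureReal_congr (hA'e.union hB'e)] at hμ
  rw [← ofReal_measureReal]
  refine ENNReal.ofReal_le_ofReal ?_
  rw [probReal_compl_eq_one_sub (hA'm.union hB'm)]
  linarith

namespace BorelEdgeDecomposition

variable {X : Type*} [MeasurableSpace X] {μ : Measure X} {H : SimpleGraph X} {ι : Type*}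
  (𝓓 : BorelEdgeDecomposition H ι)

/-- The pmp property is applied to the part of `D i` that is mapped into `s`; since `θ (rev i)`
inverts `θ i`, its image is `s ∩ D (rev i)`. -/
theorem measurePreserving (hH : IsPMPGraph H μ) (i : ι) :
    MeasurePreserving (𝓓.θ i) (μ.restrict (𝓓.D i)) (μ.restrict (𝓓.D (𝓓.rev i))) := by
  refine ⟨𝓓.measurable_θ i, ?_⟩
  ext s hs
  rw [Measure.map_apply (𝓓.measurable_θ i) hs, Measure.restrict_apply (𝓓.measurable_θ i hs),
    Measure.restrict_apply hs]
  have hinj : Set.InjOn (𝓓.θ i) (𝓓.D i) := fun x hx y hy hxy => by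
    rw [← 𝓓.θ_rev i x hx, ← 𝓓.θ_rev i y hy, hxy]
  rw [← hH (𝓓.D i) (𝓓.θ i) (𝓓.measurableSet_D i) (𝓓.measurable_θ i) hinj
    (fun x hx => (𝓓.adj i x hx).reachable) _ Set.inter_subset_right
    ((𝓓.measurable_θ i hs).inter (𝓓.measurableSet_D i))]
  congr 1
  ext y
  constructor
  · rintro ⟨x, ⟨hxs, hxD⟩, rfl⟩
    exact ⟨hxs, 𝓓.θ_mem i x hxD⟩
  · rintro ⟨hys, hyD⟩
    have h1 := 𝓓.θ_mem _ y hyD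
    have h2 := 𝓓.θ_rev _ y hyD
    rw [𝓓.rev_involutive i] at h1 h2
    exact ⟨_, ⟨by rwa [Set.mem_preimage, h2], h1⟩, h2⟩

/-- The adjacency operator, as a sum of partial compositions. -/
noncomputable def operator [Fintype ι] (hH : IsPMPGraph H μ) : Lp ℂ 2 μ →L[ℂ] Lp ℂ 2 μ :=
  ∑ i, partialComp (𝓓.measurableSet_D i) (𝓓.measurePreserving hH i)

theorem operator_apply [Fintype ι] (hH : IsPMPGraph H μ) (f : Lp ℂ 2 μ) :
    𝓓.operator hH f = ∑ i, partialComp (𝓓.measurableSet_D i) (𝓓.measurePreserving hH i) f := by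
  simp [operator]

/-- The indices `i` with `x ∈ D i` enumerate the neighbours of `x` without repetition. In particular
there are finitely many, so the `finsum` is a genuine sum. -/
theorem finsum_neighborSet [Fintype ι] (f : X → ℂ) (x : X) :
    ∑ᶠ y ∈ H.neighborSet x, f y = ∑ i, (𝓓.D i).indicator (f ∘ 𝓓.θ i) x := by
  classical
  have hbij : Set.BijOn (fun i => 𝓓.θ i x) {i | x ∈ 𝓓.D i} (H.neighborSet x) := by
    refine ⟨fun i hi => 𝓓.adj i x hi, fun i hi j hj hij => ?_, fun y hy => ?_⟩
    · exact (𝓓.existsUnique x _ (𝓓.adj j x hj)).unique ⟨hi, hij⟩ ⟨hj, rfl⟩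
    · obtain ⟨i, ⟨hi, hiy⟩, -⟩ := 𝓓.existsUnique x y hy
      exact ⟨i, hi, hiy⟩
  rw [← finsum_mem_eq_of_bijOn (f := fun i => f (𝓓.θ i x)) _ hbij fun _ _ => rfl,
    ← finsum_eq_sum_of_fintype]
  refine finsum_congr fun i => ?_
  by_cases hi : x ∈ 𝓓.D i <;> simp [hi]

theorem isAdjacencyOperator_operator [Fintype ι] (hH : IsPMPGraph H μ) :
    IsAdjacencyOperator H μ (𝓓.operator hH) := by
  intro f hf
  rw [operator_apply]
  have h : ∀ᵐ x ∂μ, ∀ i, partialComp (𝓓.measurableSet_D i) (𝓓.measurePreserving hH i)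
      (hf.toLp f) x = (𝓓.D i).indicator (f ∘ 𝓓.θ i) x :=
    Filter.eventually_all.2 fun i =>
      partialComp_toLp (𝓓.measurableSet_D i) (𝓓.measurePreserving hH i) hf
  filter_upwards [h, Lp.coeFn_finsetSum (p := 2) (μ := μ) Finset.univ
    (fun i => partialComp (𝓓.measurableSet_D i) (𝓓.measurePreserving hH i) (hf.toLp f))]
    with x h1 h2
  rw [h2, 𝓓.finsum_neighborSet, Finset.sum_apply]
  exact Finset.sum_congr rfl fun i _ => h1 i

/-- The summands for `i` and `rev i` are adjoint to each other, so taking adjoints only permutes the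
sum. -/
theorem isSelfAdjoint_operator [Fintype ι] (hH : IsPMPGraph H μ) :
    IsSelfAdjoint (𝓓.operator hH) := by
  rw [ContinuousLinearMap.isSelfAdjoint_iff_isSymmetric]
  intro f g
  change inner ℂ (𝓓.operator hH f) g = inner ℂ f (𝓓.operator hH g)
  rw [operator_apply, operator_apply, sum_inner, inner_sum,
    ← Equiv.sum_comp 𝓓.rev_involutive.toPerm fun i => inner ℂ f
      (partialComp (𝓓.measurableSet_D i) (𝓓.measurePreserving hH i) g)]
  refine Finset.sum_congr rfl fun i _ => ?_
  have h := 𝓓.measurePreserving hH (𝓓.rev i)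
  rw [𝓓.rev_involutive i] at h
  exact inner_partialComp (𝓓.measurableSet_D i) (𝓓.measurableSet_D (𝓓.rev i))
    (𝓓.measurePreserving hH i) h (𝓓.θ_rev i) f g

theorem hasSymmetricSpectrum_operator [Fintype ι] [IsProbabilityMeasure μ] (hH : IsPMPGraph H μ)
    (hbip : IsApproxMeasurablyBipartite H μ) : HasSymmetricSpectrum (𝓓.operator hH) := by
  refine hasSymmetricSpectrum_of_conj_approx_neg (𝓓.isSelfAdjoint_operator hH) fun f ε hε => ?_
  set S : ι → Lp ℂ 2 μ →L[ℂ] Lp ℂ 2 μ := fun i =>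
    partialComp (𝓓.measurableSet_D i) (𝓓.measurePreserving hH i) with hS
  -- Each summand contributes an error of at most `2 * (η + η)`.
  set η : ℝ := ε / (4 * (Fintype.card ι + 1)) with hη
  have hηpos : 0 < η := by positivity
  choose δ hδ hδS using fun i => exists_norm_indicatorMul_le (S i f) hηpos
  obtain ⟨δ', hδ', hδf⟩ := exists_norm_indicatorMul_le f hηpos
  -- One threshold serves the finitely many vectors `S i f` and `f`; `none` stands for `f` and keeps
  -- the index set nonempty.
  obtain ⟨δ₀, hδ₀, hle, hle'⟩ : ∃ δ₀ : ℝ, 0 < δ₀ ∧ δ₀ ≤ δ' ∧ ∀ i, δ₀ ≤ δ i := by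
    obtain ⟨o, ho⟩ := Finite.exists_min fun o : Option ι => o.elim δ' δ
    refine ⟨_, ?_, ho none, fun i => ho (some i)⟩
    cases o with
    | none => exact hδ'
    | some i => exact hδ i
  obtain ⟨A, B, hA, hB, hAB, hAi, hBi, hμ⟩ := hbip.exists_measurableSet hδ₀
  have hR : MeasurableSet (A ∪ B)ᶜ := (hA.union hB).compl
  refine ⟨signMul μ hB, norm_signMul hB, signMul_signMul hB, ?_⟩
  have hsplit : signMul μ hB (𝓓.operator hH (signMul μ hB f)) + 𝓓.operator hH f =
      ∑ i, (signMul μ hB (S i (signMul μ hB f)) + S i f) := by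
    rw [operator_apply, operator_apply, map_sum, Finset.sum_add_distrib]
  rw [hsplit]
  have hterm : ∀ i, ‖signMul μ hB (S i (signMul μ hB f)) + S i f‖ ≤ 4 * η := fun i => by
    refine (norm_conj_partialComp_add_le (𝓓.measurableSet_D i) hB hR
      (𝓓.measurePreserving hH i) ?_ f).trans ?_
    · intro x hx hxR hyR
      have hadj := 𝓓.adj i x hx
      rw [Set.notMem_compl_iff] at hxR hyR
      constructor
      · exact fun hxB hyB => hBi hxB hyB hadj.ne hadj
      · intro hyB
        by_contra hxB
        exact hAi (hxR.resolve_right hxB) (hyR.resolve_right hyB) hadj.ne hadj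
    · have h1 := hδS i _ hR (hμ.trans (ENNReal.ofReal_le_ofReal (hle' i)))
      have h2 := hδf _ hR (hμ.trans (ENNReal.ofReal_le_ofReal hle))
      linarith
  calc _ ≤ ∑ i : ι, 4 * η := norm_sum_le_of_le _ fun i _ => hterm i
    _ = Fintype.card ι * (4 * η) := by simp
    _ ≤ (Fintype.card ι + 1) * (4 * η) := by gcongr; linarith
    _ = ε := by rw [hη]; field_simp

end BorelEdgeDecomposition

theorem IsAdjacencyOperator.eq {X : Type*} [MeasurableSpace X] {μ : Measure X} {G : SimpleGraph X}
    {S T : Lp ℂ 2 μ →L[ℂ] Lp ℂ 2 μ} (hS : IsAdjacencyOperator G μ S)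
    (hT : IsAdjacencyOperator G μ T) : S = T := by
  ext1 f
  have h : (Lp.memLp f).toLp f = f := Lp.toLp_coeFn f _
  have h1 := hS f (Lp.memLp f)
  have h2 := hT f (Lp.memLp f)
  rw [h] at h1 h2
  exact Lp.ext (h1.trans h2.symm)

theorem theorem4p1 {X : Type*} [MeasurableSpace X] [StandardBorelSpace X]
    (μ : Measure X) [IsProbabilityMeasure μ] (G : SimpleGraph X)
    (hBorel : IsBorelGraph G) (hdeg : HasBoundedDegree G μ) (hpmp : IsPMPGraph G μ)
    (hbip : IsApproxMeasurablyBipartite G μ) :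
    (∃! T : Lp ℂ 2 μ →L[ℂ] Lp ℂ 2 μ, IsAdjacencyOperator G μ T) ∧
      ∀ T : Lp ℂ 2 μ →L[ℂ] Lp ℂ 2 μ, IsAdjacencyOperator G μ T → HasSymmetricSpectrum T := by
  obtain ⟨H, hHG, hH, ⟨d, hd⟩, hae⟩ := exists_subgraph_encard_neighborSet_le hBorel hdeg
  obtain ⟨𝓓⟩ := exists_borelEdgeDecomposition hH d hd
  have hHpmp : IsPMPGraph H μ := hpmp.mono hHG
  have hHbip : IsApproxMeasurablyBipartite H μ := fun ε hε => by
    obtain ⟨A, B, hA, hB, hAB, hAi, hBi, h⟩ := hbip ε hε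
    exact ⟨A, B, hA, hB, hAB, fun x hx y hy hxy hadj => hAi hx hy hxy (hHG hadj),
      fun x hx y hy hxy hadj => hBi hx hy hxy (hHG hadj), h⟩
  -- The neighbourhoods in `H` and `G` agree almost everywhere, so the adjacency operator of `H`
  -- also serves `G`.
  have hT : IsAdjacencyOperator G μ (𝓓.operator hHpmp) := fun f hf => by
    filter_upwards [𝓓.isAdjacencyOperator_operator hHpmp f hf, hae] with x h1 h2
    rw [h1, h2]
  refine ⟨⟨_, hT, fun S hS => hS.eq hT⟩, fun S hS => ?_⟩
  rw [hS.eq hT]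
  exact 𝓓.hasSymmetricSpectrum_operator hHpmp hHbip
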